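/- Let $\rho$ be a density operator on a finite-dimensional bipartite Hilbert space $\mathbb C^{d_A}\otimes\mathbb C^{d_B}$, let $T_B$ denote partial transposition on the second system, $\langle X,Y\rangle=\operatorname{Tr}(X^\dagger Y)$, and $\|X\|_1=\operatorname{Tr}\sqrt{X^\dagger X}$. All logarithms are to base 2. Consider the sets of Hermitian operators $$\mathsf{PPT}=\{X \mid \operatorname{Tr}X=1,\ X^{T_B}\succeq 0\},\qquad \mathsf{PPT}_+=\{X\mid \operatorname{Tr}X=1,\ X\succeq 0,\ X^{T_B}\succeq 0\},\qquad \mathsf{PPT}'=\{X\mid \|X^{T_B}\|_1\le 1\}.$$ For a set $\mathcal Q$ of Hermitian operators let $\mathcal Q^\circ=\{W=W^\dagger\mid \langle W,X\rangle\le 1\ \forall X\in\mathcal Q\}$ and, for an integer $m\ge 1$, $$G^{(m)}_{\mathcal Q}(\rho)=\sup\{\langle\rho,W\rangle \mid 0\preceq W\preceq \mathbb 1,\ W\in\tfrac1m\mathcal Q^\circ\}.$$ A completely positive trace-preserving map $\Lambda:AB\to A'B'$ is called *PPT* if its Choi matrix satisfies $J_\Lambda^{T_{BB'}}\succeq 0$,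 *$\mathsf{PPT}$-preserving* if $X\in\mathsf{PPT}\Rightarrow\Lambda(X)\in\mathsf{PPT}$, and *$\mathsf{PPT}_+$-preserving* if $\sigma\in\mathsf{PPT}_+\Rightarrow\Lambda(\sigma)\in\mathsf{PPT}_+$. For a class $\mathcal O$ of such maps let $F_{\mathcal O}(\rho,m)=\sup_\Lambda\langle\Lambda(\rho),\Psi_m\rangle$, where the supremum is over the $\Lambda\in\mathcal O$ with output space $\mathbb C^m\otimes\mathbb C^m$ and $\Psi_m$ is the projector onto $\frac1{\sqrt m}\sum_{i=1}^m|ii\rangle$. For $0\le\varepsilon\le 1$ let $$E^{(1),\varepsilon}_{d,\mathcal O}(\rho)=\log\max\{m\ge 1 \mid F_{\mathcal O}(\rho,m)\ge 1-\varepsilon\},$$ where the value is read as $+\infty$ if the set is unbounded, and for Hermitian $X$ let $$D_H^\varepsilon(\rho\|X)=-\log\min\{\langle M,X\rangle\mid 0\preceq M\preceq\mathbb 1,\ 1-\langle M,\rho\rangle\le\varepsilon\}\in(-\infty,+\infty],$$ with $\log x=-\infty$ for $x\le 0$. Put $\lfloor x\rfloor_{\log}=\log\lfloor 2^x\rfloor$,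 with $\lfloor +\infty\rfloor_{\log}=+\infty$. **Theorem.** One has $\mathsf{PPT}'=\operatorname{conv}(\mathsf{PPT}\cup-\mathsf{PPT})$. For every integer $m\ge 1$, $$F_{\mathsf{PPT}_+\text{-preserving}}(\rho,m)=G^{(m)}_{\mathsf{PPT}_+}(\rho),\qquad F_{\mathrm{PPT}}(\rho,m)=F_{\mathsf{PPT}\text{-preserving}}(\rho,m)=G^{(m)}_{\mathsf{PPT}'}(\rho).$$ For every $0\le\varepsilon\le 1$, $$E^{(1),\varepsilon}_{d,\mathsf{PPT}_+\text{-preserving}}(\rho)=\Big\lfloor\min_{\sigma\in\mathsf{PPT}_+}D_H^\varepsilon(\rho\|\sigma)\Big\rfloor_{\log},\qquad E^{(1),\varepsilon}_{d,\mathrm{PPT}}(\rho)=E^{(1),\varepsilon}_{d,\mathsf{PPT}\text{-preserving}}(\rho)=\Big\lfloor\min_{X\in\mathsf{PPT}'}D_H^\varepsilon(\rho\|X)\Big\rfloor_{\log},$$ where both minima over operators are attained; for $\varepsilon<1$ the maximum in the definition of $E^{(1),\varepsilon}_{d,\mathcal O}(\rho)$ is attained for each of the three classes. -/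

import Mathlib

open scoped ComplexOrder MatrixOrder Pointwise

noncomputable section

namespace PPTDist

/-- Operators on a finite-dimensional space with orthonormal basis indexed by `I`. -/
abbrev Op (I : Type*) := Matrix I I ℂ

/-- Linear maps from operators on `I` to operators on `J`. -/
abbrev SuperOp (I J : Type*) := Op I →ₗ[ℂ] Op J

section Operators

variable {I : Type*} [Fintype I] [DecidableEq I]

/-- Hilbert-Schmidt inner product `Tr(X† Y)`, which is real for Hermitian `X`, `Y`. -/
def hs (X Y : Op I) : ℝ := (X.conjTranspose * Y).trace.re

/-- Trace norm `‖X‖₁ = Tr |X|` with `|X| = √(X† X)`. -/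
def traceNorm (X : Op I) : ℝ := (CFC.abs X).trace.re

/-- Density operators. -/
def IsState (ρ : Op I) : Prop := ρ.PosSemidef ∧ ρ.trace = 1

/-- Polar `{W Hermitian | ⟨W, X⟩ ≤ 1 for all X ∈ Q}` of a set of Hermitian operators. -/
def polar (Q : Set (Op I)) : Set (Op I) :=
  {W | W.IsHermitian ∧ ∀ X ∈ Q, hs W X ≤ 1}

/-- `G^{(m)}_Q(ρ) = sup {⟨ρ, W⟩ | 0 ≤ W ≤ 1, W ∈ (1/m) Q°}`. -/
def G (m : ℕ) (Q : Set (Op I)) (ρ : Op I) : ℝ :=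
  sSup {r | ∃ W : Op I, W.PosSemidef ∧ (1 - W).PosSemidef ∧
    W ∈ ((m : ℝ)⁻¹) • polar Q ∧ r = hs ρ W}

/-- Base-2 logarithm with the convention `log x = -∞` for `x ≤ 0`. -/
def log2 (x : ℝ) : EReal := if x ≤ 0 then ⊥ else ((Real.logb 2 x : ℝ) : EReal)

/-- `⌊x⌋_log = log ⌊2^x⌋`, extended by `⌊±∞⌋_log = ±∞`. -/
def logFloor (x : EReal) : EReal :=
  if x = ⊤ then ⊤ else if x = ⊥ then ⊥ else log2 ((⌊(2 : ℝ) ^ x.toReal⌋ : ℤ) : ℝ)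

/-- Hypothesis testing relative entropy
`D_H^ε(ρ‖X) = -log min {⟨M, X⟩ | 0 ≤ M ≤ 1, 1 - ⟨M, ρ⟩ ≤ ε}`. -/
def DH (ε : ℝ) (ρ X : Op I) : EReal :=
  -log2 (sInf {r | ∃ M : Op I, M.PosSemidef ∧ (1 - M).PosSemidef ∧
    1 - hs M ρ ≤ ε ∧ r = hs M X})

end Operators

section Channels

variable {I J : Type*} [Fintype I] [DecidableEq I] [Fintype J] [DecidableEq J]

/-- The map `id_k ⊗ Λ`, acting by `Λ` on every block of a `k × k` block matrix. -/
def ampl (k : ℕ) (Λ : SuperOp I J) (Z : Op (Fin k × I)) : Op (Fin k × J) :=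
  Matrix.of fun p q => Λ (Matrix.of fun a b => Z (p.1, a) (q.1, b)) p.2 q.2

/-- Complete positivity: every `id_k ⊗ Λ` preserves positive semidefiniteness. -/
def IsCP (Λ : SuperOp I J) : Prop :=
  ∀ (k : ℕ) (Z : Op (Fin k × I)), Z.PosSemidef → (ampl k Λ Z).PosSemidef

/-- Completely positive trace-preserving maps. -/
def IsCPTP (Λ : SuperOp I J) : Prop := IsCP Λ ∧ ∀ X : Op I, (Λ X).trace = X.trace

/-- Choi matrix `J_Λ = ∑ |a⟩⟨b| ⊗ Λ(|a⟩⟨b|)`. -/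
def choi (Λ : SuperOp I J) : Op (I × J) :=
  Matrix.of fun p q => Λ (Matrix.single p.1 q.1 1) p.2 q.2

end Channels

section Bipartite

variable {A B A' B' : Type*} [Fintype A] [DecidableEq A] [Fintype B] [DecidableEq B]
  [Fintype A'] [DecidableEq A'] [Fintype B'] [DecidableEq B']

/-- Partial transpose on the second factor. -/
def ptB (X : Op (A × B)) : Op (A × B) :=
  Matrix.of fun p q => X (p.1, q.2) (q.1, p.2)

/-- Partial transpose on `B` and `B'` of an operator on `AB ⊗ A'B'`. -/
def ptBB' (J : Op ((A × B) × (A' × B'))) : Op ((A × B) × (A' × B')) :=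
  Matrix.of fun p q =>
    J ((p.1.1, q.1.2), (p.2.1, q.2.2)) ((q.1.1, p.1.2), (q.2.1, p.2.2))

variable (A B A' B')

/-- `PPT = {X Hermitian | Tr X = 1, X^{T_B} ≥ 0}`. -/
def PPT : Set (Op (A × B)) :=
  {X | X.IsHermitian ∧ X.trace = 1 ∧ (ptB X).PosSemidef}

/-- `PPT₊ = {X Hermitian | Tr X = 1, X ≥ 0, X^{T_B} ≥ 0}`. -/
def PPTplus : Set (Op (A × B)) :=
  {X | X.IsHermitian ∧ X.trace = 1 ∧ X.PosSemidef ∧ (ptB X).PosSemidef}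

/-- `PPT' = {X Hermitian | ‖X^{T_B}‖₁ ≤ 1}`. -/
def PPTprime : Set (Op (A × B)) :=
  {X | X.IsHermitian ∧ traceNorm (ptB X) ≤ 1}

/-- PPT operations: channels whose Choi matrix is PPT with respect to `AA'|BB'`. -/
def PPTops : Set (SuperOp (A × B) (A' × B')) :=
  {Λ | IsCPTP Λ ∧ (ptBB' (choi Λ)).PosSemidef}

/-- PPT-preserving operations. -/
def PPTpres : Set (SuperOp (A × B) (A' × B')) :=
  {Λ | IsCPTP Λ ∧ ∀ X ∈ PPT A B, Λ X ∈ PPT A' B'}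

/-- PPT₊-preserving operations. -/
def PPTplusPres : Set (SuperOp (A × B) (A' × B')) :=
  {Λ | IsCPTP Λ ∧ ∀ X ∈ PPTplus A B, Λ X ∈ PPTplus A' B'}

variable {A B A' B'}

/-- The vector `|Ψ_m⟩ = ∑ i, |ii⟩ / √m`. -/
def maxEntVec (m : ℕ) : Fin m × Fin m → ℂ :=
  fun p => if p.1 = p.2 then ((Real.sqrt m)⁻¹ : ℝ) else 0

/-- The maximally entangled state `Ψ_m = |Ψ_m⟩⟨Ψ_m|`. -/
def maxEnt (m : ℕ) : Op (Fin m × Fin m) :=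
  Matrix.vecMulVec (maxEntVec m) (star (maxEntVec m))

/-- A class of operations: for every `m`, a set of maps from `AB` to two `m`-level systems. -/
abbrev OpClass (A B : Type*) := ∀ m : ℕ, Set (SuperOp (A × B) (Fin m × Fin m))

/-- Fidelity of distillation `F_O(ρ, m) = sup {⟨Λ(ρ), Ψ_m⟩ | Λ ∈ O}`. -/
def Fid (O : OpClass A B) (ρ : Op (A × B)) (m : ℕ) : ℝ :=
  sSup {r | ∃ Λ ∈ O m, r = hs (Λ ρ) (maxEnt m)}

/-- The sizes `m ≥ 1` of the states `Ψ_m` that can be distilled with error at most `ε`. -/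
def achievable (O : OpClass A B) (ε : ℝ) (ρ : Op (A × B)) : Set ℕ :=
  {m | 1 ≤ m ∧ 1 - ε ≤ Fid O ρ m}

/-- One-shot distillable entanglement: the logarithm of the largest achievable `m`
(`+∞` if there are arbitrarily large achievable `m`). -/
def Edist (O : OpClass A B) (ε : ℝ) (ρ : Op (A × B)) : EReal :=
  ⨆ m ∈ achievable O ε ρ, log2 (m : ℝ)

end Bipartite

end PPTDist

end

/-!
Since `Ψ_m^{T_B} = F/m` with `F` the swap, an involution, `⟨Ψ_m, X⟩ ≤ 1/m` for every `X` in `PPT'`.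
Pulling `Ψ_m` back through a channel `Λ` in the Heisenberg picture therefore gives an effect
`W ∈ (1/m) Q°` with `⟨Λ(ρ), Ψ_m⟩ = ⟨ρ, W⟩`. Conversely, such a `W` is realized by measuring
`{W, 1 - W}` and preparing `Ψ_m` or `(1 - Ψ_m)/(m² - 1)`: the partial transposes of both states are
combinations of the normalized symmetric and antisymmetric projections, whose weights in the
resulting Choi matrix are `½ (1 ± m W^{T_B})` up to transposition. These are positive exactly when
`±W` is bounded by `1/m` on `PPT`.

For the one-shot quantities, Sion's theorem gives a saddle point of `⟨M, X⟩` over tests `M` and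
operators `X ∈ Q`. Its value `v` satisfies `min D_H = -log v`, and `m` is achievable if and only if
`m v ≤ 1`, so for `ε < 1`, where `v > 0`, the largest achievable `m` is `⌊1/v⌋`. For `ε = 1` the
test `M = 0` makes both sides infinite.
-/

namespace PPTDist

open Matrix
open scoped Kronecker

theorem convex_setOf_posSemidef {I : Type*} : Convex ℝ {P : Op I | P.PosSemidef} :=
  fun _ hP _ hQ _ _ ha hb _ => (hP.smul ha).add (hQ.smul hb)

section Operators

variable {I : Type*} [Fintype I]

theorem exists_eq_conjTranspose_mul_self {P : Op I} (hP : P.PosSemidef) :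
    ∃ C : Op I, P = Cᴴ * C := by
  classical
  exact CStarAlgebra.nonneg_iff_eq_star_mul_self.mp (nonneg_iff_posSemidef.mpr hP)

theorem trace_mul_nonneg {P Q : Op I} (hP : P.PosSemidef) (hQ : Q.PosSemidef) :
    0 ≤ (P * Q).trace := by
  obtain ⟨C, rfl⟩ := exists_eq_conjTranspose_mul_self hQ
  rw [← Matrix.mul_assoc, trace_mul_comm, ← Matrix.mul_assoc]
  exact (hP.mul_mul_conjTranspose_same C).trace_nonneg

theorem posSemidef_iff_forall_trace_mul_nonneg {M : Op I} :
    M.PosSemidef ↔ ∀ P : Op I, P.PosSemidef → 0 ≤ (M * P).trace := by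
  refine ⟨fun hM P => trace_mul_nonneg hM, fun h => ?_⟩
  classical
  rw [← isPositive_toEuclideanLin_iff, LinearMap.isPositive_iff_complex]
  intro x
  have hinner : inner ℂ (M.toEuclideanLin x) x =
      star (M * vecMulVec (x : I → ℂ) (star (x : I → ℂ))).trace := by
    rw [mul_vecMulVec, trace_vecMulVec, dotProduct_comm, ← inner_conj_symm,
      EuclideanSpace.inner_eq_star_dotProduct]
    simp [toLpLin_apply, dotProduct_comm]
  have hnonneg := Complex.nonneg_iff.mp (h _ (posSemidef_vecMulVec_self_star (x : I → ℂ)))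
  rw [hinner]
  exact ⟨Complex.ext (by simp) (by simp [← hnonneg.2]), by simpa using hnonneg.1⟩

theorem trace_re_nonneg {P : Op I} (hP : P.PosSemidef) : 0 ≤ P.trace.re :=
  (Complex.nonneg_iff.mp hP.trace_nonneg).1

theorem ofReal_trace_re {X : Op I} (hX : X.IsHermitian) : (X.trace.re : ℂ) = X.trace := by
  refine Complex.conj_eq_iff_re.mp ?_
  rw [starRingEnd_apply, ← trace_conjTranspose, hX.eq]

theorem trace_re_eq_zero_iff {P : Op I} (hP : P.PosSemidef) : P.trace.re = 0 ↔ P = 0 := by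
  rw [← hP.trace_eq_zero_iff, ← ofReal_trace_re hP.1, Complex.ofReal_re, Complex.ofReal_eq_zero]

theorem trace_inv_trace_re_smul {P : Op I} (hP : P.IsHermitian) (h0 : P.trace.re ≠ 0) :
    (P.trace.re⁻¹ • P).trace = 1 := by
  rw [trace_smul, ← ofReal_trace_re hP, Complex.ofReal_re, Complex.real_smul,
    ← Complex.ofReal_mul, inv_mul_cancel₀ h0, Complex.ofReal_one]

theorem posSemidef_one_add_of_mul_self [DecidableEq I] {S : Op I} (hS : S.IsHermitian)
    (h : S * S = 1) : (1 + S).PosSemidef := by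
  have hsq : (1 + S)ᴴ * (1 + S) = (2 : ℝ) • (1 + S) := by
    rw [(isHermitian_one.add hS).eq, add_mul, mul_add, mul_add, h, two_smul, mul_one,
      mul_one, one_mul, add_comm S 1]
  have := (posSemidef_conjTranspose_mul_self (1 + S)).smul
    (inv_nonneg.mpr (zero_le_two (α := ℝ)))
  rwa [hsq, inv_smul_smul₀ two_ne_zero] at this

end Operators

section HilbertSchmidt

variable {I : Type*} [Fintype I]

/-- The Hilbert-Schmidt inner product as a real bilinear form. -/
noncomputable def hsForm : LinearMap.BilinForm ℝ (Op I) :=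
  LinearMap.mk₂ ℝ hs (fun X Y Z => by simp [hs, Matrix.add_mul]) (fun r X Y => by simp [hs])
    (fun X Y Z => by simp [hs, Matrix.mul_add]) (fun r X Y => by simp [hs])

theorem hs_sub_left (X Y Z : Op I) : hs (X - Y) Z = hs X Z - hs Y Z := hsForm.map_sub₂ X Y Z

theorem hs_sub_right (X Y Z : Op I) : hs X (Y - Z) = hs X Y - hs X Z := map_sub (hsForm X) Y Z

theorem hs_add_right (X Y Z : Op I) : hs X (Y + Z) = hs X Y + hs X Z := map_add (hsForm X) Y Z

theorem hs_neg_left (X Y : Op I) : hs (-X) Y = -hs X Y := hsForm.map_neg₂ X Y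

theorem hs_neg_right (X Y : Op I) : hs X (-Y) = -hs X Y := map_neg (hsForm X) Y

theorem hs_zero_left (X : Op I) : hs 0 X = 0 := hsForm.map_zero₂ X

theorem hs_smul_left (r : ℝ) (X Y : Op I) : hs (r • X) Y = r * hs X Y := hsForm.map_smul₂ r X Y

theorem hs_smul_right (r : ℝ) (X Y : Op I) : hs X (r • Y) = r * hs X Y := map_smul (hsForm X) r Y

theorem hs_comm (X Y : Op I) : hs X Y = hs Y X := by
  rw [hs, hs, ← conjTranspose_conjTranspose X, ← conjTranspose_mul, trace_conjTranspose,
    conjTranspose_conjTranspose, Complex.star_def, Complex.conj_re]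

theorem hs_one_left [DecidableEq I] (X : Op I) : hs 1 X = X.trace.re := by
  rw [hs, conjTranspose_one, Matrix.one_mul]

theorem hs_eq_trace_mul_re {W : Op I} (hW : W.IsHermitian) (X : Op I) :
    hs W X = (W * X).trace.re := by
  rw [hs, hW.eq]

theorem trace_mul_eq_hs {W X : Op I} (hW : W.IsHermitian) (hX : X.IsHermitian) :
    (W * X).trace = (hs W X : ℂ) := by
  rw [hs_eq_trace_mul_re hW]
  refine (Complex.conj_eq_iff_re.mp ?_).symm
  rw [starRingEnd_apply, ← trace_conjTranspose, conjTranspose_mul, hW.eq, hX.eq, trace_mul_comm]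

theorem hs_nonneg {P Q : Op I} (hP : P.PosSemidef) (hQ : Q.PosSemidef) : 0 ≤ hs P Q := by
  rw [hs_eq_trace_mul_re hP.1]
  exact (Complex.nonneg_iff.mp (trace_mul_nonneg hP hQ)).1

theorem hs_pos {M X : Op I} (hM : M.PosSemidef) (hM0 : M ≠ 0) (hX : X.PosDef) : 0 < hs M X := by
  classical
  refine (hs_nonneg hM hX.posSemidef).lt_of_ne' fun h => hM0 ?_
  obtain ⟨C, rfl⟩ := exists_eq_conjTranspose_mul_self hM
  obtain ⟨D, rfl⟩ := exists_eq_conjTranspose_mul_self hX.posSemidef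
  have htr : ((Cᴴ * C) * (Dᴴ * D)).trace = ((D * Cᴴ)ᴴ * (D * Cᴴ)).trace := by
    rw [conjTranspose_mul, conjTranspose_conjTranspose, Matrix.mul_assoc, trace_mul_comm]
    simp only [Matrix.mul_assoc]
  rw [hs_eq_trace_mul_re hM.1, htr, trace_re_eq_zero_iff (posSemidef_conjTranspose_mul_self _),
    conjTranspose_mul_self_eq_zero] at h
  have hXC : Dᴴ * D * Cᴴ = 0 := by rw [Matrix.mul_assoc, h, Matrix.mul_zero]
  rw [hX.isUnit.mul_right_eq_zero.mp hXC, Matrix.zero_mul]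

theorem hs_le_trace_re [DecidableEq I] {W P : Op I} (hW : (1 - W).PosSemidef)
    (hP : P.PosSemidef) : hs W P ≤ P.trace.re := by
  rw [← sub_nonneg, ← hs_one_left, ← hs_sub_left]
  exact hs_nonneg hW hP

theorem continuous_hs_left (X : Op I) : Continuous fun W => hs W X := by
  unfold hs
  fun_prop

theorem continuous_hs_right (W : Op I) : Continuous (hs W) := by
  unfold hs
  fun_prop

theorem posSemidef_one_sub_of_forall_hs_le_one [DecidableEq I] {H : Op I} (hH : H.IsHermitian)
    (h : ∀ P : Op I, IsState P → hs H P ≤ 1) : (1 - H).PosSemidef := by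
  refine posSemidef_iff_forall_trace_mul_nonneg.mpr fun P hP => ?_
  rw [trace_mul_eq_hs (isHermitian_one.sub hH) hP.1, Complex.zero_le_real, hs_sub_left,
    hs_one_left, sub_nonneg]
  rcases (trace_re_nonneg hP).eq_or_lt with h0 | h0
  · rw [(trace_re_eq_zero_iff hP).mp h0.symm, hs_comm, hs_zero_left, trace_zero, Complex.zero_re]
  · have := h (P.trace.re⁻¹ • P) ⟨hP.smul (inv_nonneg.mpr h0.le),
      trace_inv_trace_re_smul hP.1 h0.ne'⟩
    rwa [hs_smul_right, inv_mul_le_one₀ h0] at this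

end HilbertSchmidt

section TraceNorm

variable {I : Type*} [Fintype I] [DecidableEq I]

theorem exists_posSemidef_sub_eq {Y : Op I} (hY : Y.IsHermitian) :
    ∃ P N : Op I, P.PosSemidef ∧ N.PosSemidef ∧ Y = P - N ∧
      P.trace.re + N.trace.re = traceNorm Y := by
  have hY' : IsSelfAdjoint Y := hY
  refine ⟨Y⁺, Y⁻, nonneg_iff_posSemidef.mp (CFC.posPart_nonneg Y),
    nonneg_iff_posSemidef.mp (CFC.negPart_nonneg Y), (CFC.posPart_sub_negPart Y).symm, ?_⟩
  rw [traceNorm, ← CFC.posPart_add_negPart Y, trace_add, Complex.add_re]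

theorem exists_traceNorm_eq_hs {Y : Op I} (hY : Y.IsHermitian) :
    ∃ W : Op I, (1 - W).PosSemidef ∧ (1 + W).PosSemidef ∧ traceNorm Y = hs W Y := by
  have hY' : IsSelfAdjoint Y := hY
  let sgn : ℝ → ℝ := fun x => SignType.sign x
  have hcont : ContinuousOn sgn (spectrum ℝ Y) := Y.finite_real_spectrum.continuousOn _
  have hle : cfc sgn Y ≤ 1 := cfc_le_one sgn Y fun x _ => by
    rcases lt_trichotomy x 0 with h | rfl | h <;> simp [sgn, *]
  have hge : 0 ≤ cfc (fun x => 1 + sgn x) Y := cfc_nonneg fun x _ => by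
    rcases lt_trichotomy x 0 with h | rfl | h <;> simp [sgn, *]
  rw [cfc_const_add 1 sgn Y, map_one] at hge
  refine ⟨cfc sgn Y, le_iff.mp hle, ?_, ?_⟩
  · exact nonneg_iff_posSemidef.mp hge
  · rw [hs_eq_trace_mul_re (cfc_predicate sgn Y), traceNorm, CFC.abs_eq_cfc_norm Y]
    nth_rw 3 [← cfc_id ℝ Y]
    rw [← cfc_mul sgn id Y]
    congr 3
    ext x
    simp [sgn]

theorem traceNorm_sub_le {P N : Op I} (hP : P.PosSemidef) (hN : N.PosSemidef) :
    traceNorm (P - N) ≤ P.trace.re + N.trace.re := by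
  obtain ⟨W, hW, hW', htr⟩ := exists_traceNorm_eq_hs (hP.1.sub hN.1)
  have hWN : hs (-W) N ≤ N.trace.re := hs_le_trace_re (by rwa [sub_neg_eq_add]) hN
  rw [hs_neg_left] at hWN
  rw [htr, hs_sub_right]
  linarith [hs_le_trace_re hW hP]

end TraceNorm

section Effects

variable {I : Type*}

/-- Effects, the operators `0 ≤ M ≤ 1` representing one outcome of a measurement. -/
def IsEffect [DecidableEq I] (M : Op I) : Prop := M.PosSemidef ∧ (1 - M).PosSemidef

theorem isEffect_zero [DecidableEq I] : IsEffect (0 : Op I) :=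
  ⟨PosSemidef.zero, (sub_zero (1 : Op I)).symm ▸ PosSemidef.one⟩

theorem isEffect_one [DecidableEq I] : IsEffect (1 : Op I) :=
  ⟨PosSemidef.one, (sub_self (1 : Op I)).symm ▸ PosSemidef.zero⟩

theorem convex_setOf_isEffect [DecidableEq I] : Convex ℝ {M : Op I | IsEffect M} := by
  refine convex_setOf_posSemidef.inter fun M hM N hN a b ha hb hab => ?_
  have hsub : (1 : Op I) - (a • M + b • N) = a • (1 - M) + b • (1 - N) := by
    rw [smul_sub, smul_sub, sub_add_sub_comm, ← add_smul, hab, one_smul]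
  change (1 - (a • M + b • N)).PosSemidef
  rw [hsub]
  exact convex_setOf_posSemidef hM hN ha hb hab

theorem isClosed_setOf_posSemidef [Finite I] : IsClosed {P : Op I | P.PosSemidef} := by
  cases nonempty_fintype I
  have hdual : {P : Op I | P.PosSemidef} =
      ⋂ (Q : Op I) (_ : Q.PosSemidef), {P | 0 ≤ (P * Q).trace} := by
    ext P
    simpa only [Set.mem_iInter, Set.mem_ofPred_eq] using posSemidef_iff_forall_trace_mul_nonneg
  rw [hdual]
  exact isClosed_biInter fun Q _ => isClosed_le continuous_const (by fun_prop)

variable [Fintype I]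

theorem re_trace_conjTranspose_mul_self (C : Op I) :
    (Cᴴ * C).trace.re = ∑ j, ∑ i, ‖C i j‖ ^ 2 := by
  simp [trace, Matrix.mul_apply, Complex.sq_norm, Complex.normSq_apply]

theorem isCompact_setOf_posSemidef_trace_le (c : ℝ) :
    IsCompact {P : Op I | P.PosSemidef ∧ P.trace.re ≤ c} := by
  have hbox : IsCompact (Set.univ.pi fun _ : I => Set.univ.pi fun _ : I =>
      Metric.closedBall (0 : ℂ) (Real.sqrt c)) :=
    isCompact_univ_pi fun _ => isCompact_univ_pi fun _ => isCompact_closedBall _ _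
  have hsq : Continuous fun C : Op I => Cᴴ * C := by fun_prop
  refine (hbox.image hsq).of_isClosed_subset
    (isClosed_setOf_posSemidef.inter (isClosed_le (f := fun P : Op I => P.trace.re)
      (by fun_prop) continuous_const)) ?_
  rintro P ⟨hP, hc⟩
  obtain ⟨C, rfl⟩ := exists_eq_conjTranspose_mul_self hP
  refine ⟨C, fun i _ j _ => mem_closedBall_zero_iff.mpr (Real.le_sqrt_of_sq_le ?_), rfl⟩
  calc ‖C i j‖ ^ 2 ≤ ∑ i, ‖C i j‖ ^ 2 :=
        Finset.single_le_sum (f := fun i => ‖C i j‖ ^ 2) (fun _ _ => sq_nonneg _)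
          (Finset.mem_univ i)
    _ ≤ ∑ j, ∑ i, ‖C i j‖ ^ 2 :=
        Finset.single_le_sum (f := fun j => ∑ i, ‖C i j‖ ^ 2)
          (fun _ _ => Finset.sum_nonneg fun _ _ => sq_nonneg _) (Finset.mem_univ j)
    _ ≤ c := (re_trace_conjTranspose_mul_self C).symm.trans_le hc

variable [DecidableEq I]

theorem isEffect_of_mul_self {P : Op I} (hP : P.IsHermitian) (h : P * P = P) : IsEffect P := by
  have hproj : IsStarProjection P := ⟨h, hP⟩
  exact ⟨nonneg_iff_posSemidef.mp hproj.nonneg, nonneg_iff_posSemidef.mp hproj.one_sub_nonneg⟩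

theorem isCompact_setOf_isEffect {I : Type*} [Finite I] [DecidableEq I] :
    IsCompact {M : Op I | IsEffect M} := by
  cases nonempty_fintype I
  refine (isCompact_setOf_posSemidef_trace_le (I := I) (Fintype.card I)).of_isClosed_subset
    (isClosed_setOf_posSemidef.inter
      (isClosed_setOf_posSemidef.preimage (continuous_const.sub continuous_id))) ?_
  rintro M ⟨h0, h1⟩
  have := trace_re_nonneg h1
  rw [trace_sub, trace_one, Complex.sub_re, Complex.natCast_re] at this
  exact ⟨h0, by linarith⟩

end Effects

section PartialTranspose

variable {A B : Type*}

/-- The partial transpose on the second factor as a linear map. -/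
def ptBMap : SuperOp (A × B) (A × B) where
  toFun := ptB
  map_add' _ _ := rfl
  map_smul' _ _ := rfl

theorem ptB_apply (X : Op (A × B)) (p q : A × B) : ptB X p q = X (p.1, q.2) (q.1, p.2) := rfl

theorem ptB_ptB (X : Op (A × B)) : ptB (ptB X) = X := rfl

theorem ptB_add (X Y : Op (A × B)) : ptB (X + Y) = ptB X + ptB Y := rfl

theorem ptB_sub (X Y : Op (A × B)) : ptB (X - Y) = ptB X - ptB Y := rfl

theorem ptB_neg (X : Op (A × B)) : ptB (-X) = -ptB X := rfl

theorem ptB_smul {R : Type*} [SMul R ℂ] (r : R) (X : Op (A × B)) : ptB (r • X) = r • ptB X := rfl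

theorem isHermitian_ptB {X : Op (A × B)} (hX : X.IsHermitian) : (ptB X).IsHermitian :=
  IsHermitian.ext fun _ _ => hX.apply _ _

theorem continuous_ptB : Continuous (ptB : Op (A × B) → Op (A × B)) :=
  continuous_matrix fun _ _ => continuous_apply_apply _ _

theorem ptB_single [DecidableEq A] [DecidableEq B] (a b : A × B) :
    ptB (single a b (1 : ℂ)) = single (a.1, b.2) (b.1, a.2) 1 := by
  ext p q
  simp only [ptB_apply, single_apply, Prod.ext_iff]
  congr 1
  grind

theorem ptB_one [DecidableEq A] [DecidableEq B] : ptB (1 : Op (A × B)) = 1 := by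
  ext p q
  simp only [ptB_apply, one_apply, Prod.ext_iff]
  congr 1
  grind

variable [Fintype A] [Fintype B]

theorem trace_ptB (X : Op (A × B)) : (ptB X).trace = X.trace := rfl

theorem trace_ptB_mul_ptB (X Y : Op (A × B)) : (ptB X * ptB Y).trace = (X * Y).trace := by
  simp only [trace, diag_apply, Matrix.mul_apply, ptB_apply, Fintype.sum_prod_type]
  refine Finset.sum_congr rfl fun a _ => ?_
  conv_lhs => rw [Finset.sum_comm]
  conv_rhs => rw [Finset.sum_comm]
  exact Finset.sum_congr rfl fun a' _ => Finset.sum_comm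

theorem hs_ptB_left {X : Op (A × B)} (hX : X.IsHermitian) (Y : Op (A × B)) :
    hs (ptB X) Y = hs X (ptB Y) := by
  rw [hs_eq_trace_mul_re hX, hs_eq_trace_mul_re (isHermitian_ptB hX), ← trace_ptB_mul_ptB X,
    ptB_ptB]

end PartialTranspose

section PPTSets

variable {A B : Type*} [Fintype A] [Fintype B]

theorem PPTplus_subset_PPT : PPTplus A B ⊆ PPT A B := fun _ ⟨h1, h2, _, h4⟩ => ⟨h1, h2, h4⟩

theorem convex_PPTplus : Convex ℝ (PPTplus A B) := by
  rintro X ⟨_, hX, hXpos, hXpt⟩ Y ⟨_, hY, hYpos, hYpt⟩ a b ha hb hab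
  have hpos := convex_setOf_posSemidef hXpos hYpos ha hb hab
  refine ⟨hpos.1, ?_, hpos, convex_setOf_posSemidef hXpt hYpt ha hb hab⟩
  rw [trace_add, trace_smul, trace_smul, hX, hY, ← add_smul, hab, one_smul]

theorem isCompact_PPTplus : IsCompact (PPTplus A B) := by
  refine (isCompact_setOf_posSemidef_trace_le (I := A × B) 1).of_isClosed_subset
    ((isClosed_eq (by fun_prop) continuous_id).inter ((isClosed_eq (by fun_prop)
      continuous_const).inter (isClosed_setOf_posSemidef.inter
        (isClosed_setOf_posSemidef.preimage continuous_ptB)))) ?_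
  rintro X ⟨_, htr, hpos, _⟩
  exact ⟨hpos, by rw [htr, Complex.one_re]⟩

/-- The maximally mixed state. -/
noncomputable def maxMixed (I : Type*) [Fintype I] [DecidableEq I] : Op I :=
  (Fintype.card I : ℝ)⁻¹ • 1

theorem posDef_maxMixed {I : Type*} [Fintype I] [DecidableEq I] [Nonempty I] :
    (maxMixed I).PosDef :=
  PosDef.one.smul (by positivity)

theorem trace_maxMixed {I : Type*} [Fintype I] [DecidableEq I] [Nonempty I] :
    (maxMixed I).trace = 1 := by
  simp [maxMixed]

theorem maxMixed_mem_PPTplus [DecidableEq A] [DecidableEq B] [Nonempty A] [Nonempty B] :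
    maxMixed (A × B) ∈ PPTplus A B :=
  ⟨posDef_maxMixed.1, trace_maxMixed, posDef_maxMixed.posSemidef, by
    rw [maxMixed, ptB_smul, ptB_one]; exact posDef_maxMixed.posSemidef⟩

theorem ptB_mem_PPT {P : Op (A × B)} (hP : IsState P) : ptB P ∈ PPT A B :=
  ⟨isHermitian_ptB hP.1.1, hP.2, hP.1⟩

theorem exists_mem_PPT_ptB_eq_smul [Nonempty A] [Nonempty B] {P : Op (A × B)}
    (hP : P.PosSemidef) : ∃ Z ∈ PPT A B, ptB P = P.trace.re • Z := by
  classical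
  rcases (trace_re_nonneg hP).eq_or_lt with h0 | h0
  · refine ⟨_, PPTplus_subset_PPT maxMixed_mem_PPTplus, ?_⟩
    rw [← h0, zero_smul, (trace_re_eq_zero_iff hP).mp h0.symm]
    rfl
  · refine ⟨ptB (P.trace.re⁻¹ • P), ptB_mem_PPT ⟨hP.smul
      (inv_nonneg.mpr h0.le), trace_inv_trace_re_smul hP.1 h0.ne'⟩, ?_⟩
    rw [ptB_smul, smul_inv_smul₀ h0.ne']

/-- Pairs of positive semidefinite operators of total trace at most one. The trace-norm unit ball
of Hermitian operators consists of their differences. -/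
def subnormalizedPairs (I : Type*) [Fintype I] : Set (Op I × Op I) :=
  ({P | P.PosSemidef} ×ˢ {N | N.PosSemidef}) ∩ {p | p.1.trace.re + p.2.trace.re ≤ 1}

theorem convex_subnormalizedPairs {I : Type*} [Fintype I] : Convex ℝ (subnormalizedPairs I) := by
  refine (convex_setOf_posSemidef.prod convex_setOf_posSemidef).inter
    (convex_halfSpace_le ⟨fun p q => ?_, fun r p => ?_⟩ 1)
  · simp only [Prod.fst_add, Prod.snd_add, trace_add, Complex.add_re]
    ring
  · simp only [Prod.smul_fst, Prod.smul_snd, trace_smul, Complex.smul_re, smul_add]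

theorem isCompact_subnormalizedPairs {I : Type*} [Fintype I] :
    IsCompact (subnormalizedPairs I) := by
  have hK := isCompact_setOf_posSemidef_trace_le (I := I) 1
  refine (hK.prod hK).of_isClosed_subset ((isClosed_setOf_posSemidef.prod
    isClosed_setOf_posSemidef).inter (isClosed_le (by fun_prop) continuous_const)) ?_
  rintro ⟨P, N⟩ ⟨⟨hP, hN⟩, h⟩
  exact ⟨⟨hP, (le_add_of_nonneg_right (trace_re_nonneg hN)).trans h⟩,
    ⟨hN, (le_add_of_nonneg_left (trace_re_nonneg hP)).trans h⟩⟩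

variable [DecidableEq A] [DecidableEq B]

theorem PPTprime_eq_image :
    PPTprime A B = (fun p => ptB (p.1 - p.2)) '' subnormalizedPairs (A × B) := by
  ext X
  constructor
  · rintro ⟨hX, h⟩
    obtain ⟨P, N, hP, hN, hPN, htr⟩ := exists_posSemidef_sub_eq (isHermitian_ptB hX)
    exact ⟨(P, N), ⟨⟨hP, hN⟩, htr.trans_le h⟩, congrArg ptB hPN.symm⟩
  · rintro ⟨⟨P, N⟩, ⟨⟨hP, hN⟩, h⟩, rfl⟩
    exact ⟨isHermitian_ptB (hP.1.sub hN.1), (traceNorm_sub_le hP hN).trans h⟩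

theorem convex_PPTprime : Convex ℝ (PPTprime A B) := by
  rw [PPTprime_eq_image]
  exact convex_subnormalizedPairs.is_linear_image
    ((ptBMap ∘ₗ (LinearMap.fst ℂ _ _ - LinearMap.snd ℂ _ _)).restrictScalars ℝ).isLinear

theorem isCompact_PPTprime : IsCompact (PPTprime A B) := by
  rw [PPTprime_eq_image]
  exact isCompact_subnormalizedPairs.image
    (continuous_ptB.comp (continuous_fst.sub continuous_snd))

theorem neg_mem_PPTprime {X : Op (A × B)} (hX : X ∈ PPTprime A B) : -X ∈ PPTprime A B := by
  rw [PPTprime_eq_image] at hX ⊢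
  obtain ⟨⟨P, N⟩, ⟨⟨hP, hN⟩, h⟩, rfl⟩ := hX
  exact ⟨(N, P), ⟨⟨hN, hP⟩, (add_comm N.trace.re P.trace.re).trans_le h⟩,
    congrArg ptB (neg_sub P N).symm⟩

theorem PPT_subset_PPTprime : PPT A B ⊆ PPTprime A B := by
  rintro X ⟨_, htr, hpos⟩
  rw [PPTprime_eq_image]
  refine ⟨(ptB X, 0), ⟨⟨hpos, PosSemidef.zero⟩, ?_⟩, congrArg ptB (sub_zero (ptB X))⟩
  simp [trace_ptB, htr]

theorem PPTprime_eq_convexHull [Nonempty A] [Nonempty B] :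
    PPTprime A B = convexHull ℝ (PPT A B ∪ -PPT A B) := by
  refine Set.Subset.antisymm ?_ (convexHull_min (Set.union_subset PPT_subset_PPTprime
    fun X hX => neg_neg X ▸ neg_mem_PPTprime (PPT_subset_PPTprime hX)) convex_PPTprime)
  rw [convexHull_union_neg_eq_absConvexHull, PPTprime_eq_image]
  rintro _ ⟨⟨P, N⟩, ⟨⟨hP, hN⟩, h⟩, rfl⟩
  obtain ⟨X, hX, hPX⟩ := exists_mem_PPT_ptB_eq_smul hP
  obtain ⟨Y, hY, hNY⟩ := exists_mem_PPT_ptB_eq_smul hN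
  obtain ⟨Z, hZ, hXYZ⟩ := convex_absConvexHull.exists_mem_add_smul_eq
    (subset_absConvexHull hX) (balanced_absConvexHull.neg_mem_iff.mpr (subset_absConvexHull hY))
    (trace_re_nonneg hP) (trace_re_nonneg hN)
  have hnorm : ‖P.trace.re + N.trace.re‖ ≤ 1 := by
    rwa [Real.norm_of_nonneg (add_nonneg (trace_re_nonneg hP) (trace_re_nonneg hN))]
  change ptB P - ptB N ∈ _
  rw [hPX, hNY, sub_eq_add_neg, ← smul_neg, ← hXYZ]
  exact balanced_absConvexHull.smul_mem hnorm hZ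

theorem trace_re_le_one_of_mem_PPTprime {X : Op (A × B)} (hX : X ∈ PPTprime A B) :
    X.trace.re ≤ 1 := by
  rw [PPTprime_eq_image] at hX
  obtain ⟨⟨P, N⟩, ⟨⟨-, hN⟩, h⟩, rfl⟩ := hX
  have : P.trace.re + N.trace.re ≤ 1 := h
  rw [trace_ptB, trace_sub, Complex.sub_re]
  linarith [trace_re_nonneg hN]

end PPTSets

section Channels

variable {I J : Type*}

theorem IsCP.posSemidef_apply {Λ : SuperOp I J} (h : IsCP Λ) {P : Op I} (hP : P.PosSemidef) :
    (Λ P).PosSemidef :=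
  (h 1 (P.submatrix Prod.snd Prod.snd) (hP.submatrix _)).submatrix fun j => ((0 : Fin 1), j)

variable [Fintype I]

theorem posSemidef_sum_blocks [Finite J] {N : Op (J × I)} (hN : N.PosSemidef) :
    (of fun p q => ∑ a, ∑ b, N (p, a) (q, b) : Op J).PosSemidef := by
  classical
  cases nonempty_fintype J
  convert hN.conjTranspose_mul_mul_same (of fun (x : J × I) q => if x.1 = q then (1 : ℂ) else 0)
  ext p q
  simpa [Matrix.mul_apply, Fintype.sum_prod_type_right, apply_ite (star : ℂ → ℂ)] using
    Finset.sum_comm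

variable [DecidableEq I]

theorem superOp_apply_eq_sum (Λ : SuperOp I J) (X : Op I) :
    Λ X = ∑ a, ∑ b, X a b • Λ (single a b 1) := by
  conv_lhs => rw [matrix_eq_sum_single X]
  simp only [map_sum, ← map_smul, smul_single, smul_eq_mul, mul_one]

/-- The map measuring the effect `W` and preparing `S` or `R` according to the outcome. -/
def measurePrepare (W : Op I) (S R : Op J) : SuperOp I J where
  toFun X := (W * X).trace • S + ((1 - W) * X).trace • R
  map_add' X Y := by simp only [Matrix.mul_add, trace_add]; module
  map_smul' c X := by simp only [Matrix.mul_smul, trace_smul, RingHom.id_apply]; module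

theorem measurePrepare_apply (W : Op I) (S R : Op J) (X : Op I) :
    measurePrepare W S R X = (W * X).trace • S + ((1 - W) * X).trace • R := rfl

theorem choi_measurePrepare (W : Op I) (S R : Op J) :
    choi (measurePrepare W S R) = Wᵀ ⊗ₖ S + (1 - W)ᵀ ⊗ₖ R := by
  ext p q
  have htrace (V : Op I) : (V * single p.1 q.1 (1 : ℂ)).trace = V q.1 p.1 := by
    rw [trace_mul_comm, trace_single_mul, one_smul]
  simp only [choi, of_apply, measurePrepare_apply, htrace, Matrix.add_apply,
    Matrix.smul_apply, kroneckerMap_apply, transpose_apply, smul_eq_mul]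

theorem isCP_of_posSemidef_choi {I J : Type*} [Finite I] [DecidableEq I] [Finite J]
    {Λ : SuperOp I J} (h : (choi Λ).PosSemidef) : IsCP Λ := by
  cases nonempty_fintype I
  intro k Z hZ
  -- `(id ⊗ Λ)(Z)` is the contraction of `Z ⊗ J_Λ` over the two copies of the input space.
  have hsub := (hZ.kronecker h).submatrix
    fun x : (Fin k × J) × I => ((x.1.1, x.2), (x.2, x.1.2))
  convert posSemidef_sum_blocks hsub using 1
  ext p q
  simp only [ampl, of_apply, superOp_apply_eq_sum Λ (of _), Matrix.sum_apply, Matrix.smul_apply,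
    smul_eq_mul, submatrix_apply, kroneckerMap_apply, choi]

variable [Fintype J]

/-- The adjoint `Λ†` of `Λ` for the bilinear pairing `Tr(X Y)`, which transports observables
backwards along `Λ` (Heisenberg picture). -/
def heisenberg (Λ : SuperOp I J) (T : Op J) : Op I :=
  of fun b a => (T * Λ (single a b 1)).trace

theorem trace_heisenberg_mul (Λ : SuperOp I J) (T : Op J) (X : Op I) :
    (heisenberg Λ T * X).trace = (T * Λ X).trace := by
  simp only [superOp_apply_eq_sum Λ X, Matrix.mul_sum, trace_sum, Matrix.mul_smul, trace_smul,
    smul_eq_mul]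
  rw [trace, Finset.sum_comm]
  simp only [diag_apply, Matrix.mul_apply, heisenberg, of_apply, mul_comm]

theorem IsCPTP.isEffect_heisenberg [DecidableEq J] {Λ : SuperOp I J} (h : IsCPTP Λ) {T : Op J}
    (hT : IsEffect T) : IsEffect (heisenberg Λ T) := by
  constructor <;> refine posSemidef_iff_forall_trace_mul_nonneg.mpr fun P hP => ?_
  · rw [trace_heisenberg_mul]
    exact trace_mul_nonneg hT.1 (h.1.posSemidef_apply hP)
  · have htrace : ((1 - heisenberg Λ T) * P).trace = ((1 - T) * Λ P).trace := by
      rw [Matrix.sub_mul, Matrix.sub_mul, trace_sub, trace_sub, trace_heisenberg_mul,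
        Matrix.one_mul, Matrix.one_mul, h.2]
    rw [htrace]
    exact trace_mul_nonneg hT.2 (h.1.posSemidef_apply hP)

theorem isCPTP_measurePrepare {W : Op I} {S R : Op J} (hW : IsEffect W) (hS : IsState S)
    (hR : IsState R) : IsCPTP (measurePrepare W S R) := by
  refine ⟨isCP_of_posSemidef_choi ?_, fun X => ?_⟩
  · rw [choi_measurePrepare]
    exact (hW.1.transpose.kronecker hS.1).add (hW.2.transpose.kronecker hR.1)
  · rw [measurePrepare_apply, trace_add, trace_smul, trace_smul, hS.2, hR.2, ← add_smul,
      ← trace_add, ← Matrix.add_mul, add_sub_cancel, Matrix.one_mul, smul_eq_mul, mul_one]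

end Channels

section PPTChannels

variable {A B A' B' : Type*}

/-- Conjugation of a map by the partial transpositions of its input and output. -/
def conjPtB (Λ : SuperOp (A × B) (A' × B')) : SuperOp (A × B) (A' × B') :=
  ptBMap ∘ₗ Λ ∘ₗ ptBMap

theorem choi_conjPtB [DecidableEq A] [DecidableEq B]
    (Λ : SuperOp (A × B) (A' × B')) : choi (conjPtB Λ) = ptBB' (choi Λ) := by
  ext p q
  change ptB (Λ (ptB (single p.1 q.1 1))) p.2 q.2 = _
  rw [ptB_single]
  rfl

variable [Fintype A] [Fintype B]

theorem ptBB'_choi_measurePrepare [DecidableEq A] [DecidableEq B] (W : Op (A × B))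
    (S R : Op (A' × B')) :
    ptBB' (choi (measurePrepare W S R)) = (ptB W)ᵀ ⊗ₖ ptB S + (1 - (ptB W)ᵀ) ⊗ₖ ptB R := by
  have hadd (J K : Op ((A × B) × (A' × B'))) : ptBB' (J + K) = ptBB' J + ptBB' K := rfl
  have hkronecker (X : Op (A × B)) (Y : Op (A' × B')) : ptBB' (Xᵀ ⊗ₖ Y) = (ptB X)ᵀ ⊗ₖ ptB Y := rfl
  rw [choi_measurePrepare, hadd, hkronecker, hkronecker, ptB_sub, ptB_one, transpose_sub,
    transpose_one]

variable [Fintype A'] [Fintype B']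

theorem apply_mem_PPTprime [DecidableEq A] [DecidableEq B] [DecidableEq A'] [DecidableEq B']
    [Nonempty A] [Nonempty B] {Λ : SuperOp (A × B) (A' × B')}
    (hΛ : ∀ X ∈ PPT A B, Λ X ∈ PPT A' B') {X : Op (A × B)} (hX : X ∈ PPTprime A B) :
    Λ X ∈ PPTprime A' B' := by
  have hconvex : Convex ℝ (Λ ⁻¹' PPTprime A' B') :=
    convex_PPTprime.is_linear_preimage (Λ.restrictScalars ℝ).isLinear
  rw [PPTprime_eq_convexHull] at hX
  refine convexHull_min (Set.union_subset (fun Y hY => Set.mem_preimage.mpr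
    (PPT_subset_PPTprime (hΛ Y hY))) fun Y hY => ?_) hconvex hX
  have := neg_mem_PPTprime (PPT_subset_PPTprime (hΛ (-Y) hY))
  rwa [map_neg, neg_neg] at this

theorem PPTpres_subset_PPTplusPres : PPTpres A B A' B' ⊆ PPTplusPres A B A' B' := by
  rintro Λ ⟨hΛ, hpres⟩
  refine ⟨hΛ, fun X hX => ?_⟩
  obtain ⟨h1, h2, h3⟩ := hpres X (PPTplus_subset_PPT hX)
  exact ⟨h1, h2, hΛ.1.posSemidef_apply hX.2.2.1, h3⟩

variable [DecidableEq A] [DecidableEq B]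

theorem PPTops_subset_PPTpres : PPTops A B A' B' ⊆ PPTpres A B A' B' := by
  rintro Λ ⟨hΛ, hJ⟩
  refine ⟨hΛ, fun X ⟨_, htr, hpos⟩ => ?_⟩
  rw [← choi_conjPtB] at hJ
  have h : (ptB (Λ X)).PosSemidef := (isCP_of_posSemidef_choi hJ).posSemidef_apply hpos
  exact ⟨isHermitian_ptB h.1, by rw [hΛ.2, htr], h⟩

theorem measurePrepare_one_mem_PPTops {S : Op (A' × B')} (hS : S ∈ PPTplus A' B') :
    measurePrepare 1 S S ∈ PPTops A B A' B' := by
  have hstate : IsState S := ⟨hS.2.2.1, hS.2.1⟩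
  refine ⟨isCPTP_measurePrepare isEffect_one hstate hstate, ?_⟩
  rw [ptBB'_choi_measurePrepare, ptB_one, transpose_one, sub_self, zero_kronecker, add_zero]
  exact PosSemidef.one.kronecker hS.2.2.2

end PPTChannels

section MaximallyEntangled

/-- The operator exchanging the two tensor factors. -/
def swapOp (m : ℕ) : Op (Fin m × Fin m) := of fun p q => if p = q.swap then 1 else 0

theorem isHermitian_swapOp (m : ℕ) : (swapOp m).IsHermitian := by
  ext p q
  simp only [swapOp, conjTranspose_apply, of_apply, apply_ite (star : ℂ → ℂ), star_one, star_zero]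
  grind

theorem swapOp_mul_swapOp (m : ℕ) : swapOp m * swapOp m = 1 := by
  ext p q
  simp [swapOp, Matrix.mul_apply, one_apply]

theorem posSemidef_one_add_swapOp (m : ℕ) : (1 + swapOp m).PosSemidef :=
  posSemidef_one_add_of_mul_self (isHermitian_swapOp m) (swapOp_mul_swapOp m)

theorem posSemidef_one_sub_swapOp (m : ℕ) : (1 - swapOp m).PosSemidef := by
  rw [sub_eq_add_neg]
  exact posSemidef_one_add_of_mul_self (isHermitian_swapOp m).neg
    (by rw [neg_mul_neg, swapOp_mul_swapOp])

theorem maxEnt_apply (m : ℕ) (p q : Fin m × Fin m) :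
    maxEnt m p q = if p.1 = p.2 ∧ q.1 = q.2 then ((m : ℝ)⁻¹ : ℂ) else 0 := by
  have h : ((Real.sqrt m : ℂ))⁻¹ * ((Real.sqrt m : ℂ))⁻¹ = ((m : ℝ) : ℂ)⁻¹ := by
    rw [← mul_inv, ← Complex.ofReal_mul, Real.mul_self_sqrt (Nat.cast_nonneg m)]
  by_cases h1 : p.1 = p.2 <;> by_cases h2 : q.1 = q.2 <;>
    simp [maxEnt, maxEntVec, vecMulVec_apply, h1, h2, h]

theorem ptB_maxEnt (m : ℕ) : ptB (maxEnt m) = (m : ℝ)⁻¹ • swapOp m := by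
  ext p q
  have hiff : (p.1 = q.2 ∧ q.1 = p.2) ↔ p = q.swap := by rw [Prod.ext_iff, eq_comm (a := q.1)]; rfl
  simp [ptB_apply, maxEnt_apply, hiff, swapOp]

theorem posSemidef_maxEnt (m : ℕ) : (maxEnt m).PosSemidef := posSemidef_vecMulVec_self_star _

theorem trace_maxEnt {m : ℕ} (hm : 1 ≤ m) : (maxEnt m).trace = 1 := by
  have h : (m : ℂ) ≠ 0 := Nat.cast_ne_zero.mpr (by omega)
  simp [trace, maxEnt_apply, Fintype.sum_prod_type, h]

theorem isState_maxEnt {m : ℕ} (hm : 1 ≤ m) : IsState (maxEnt m) :=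
  ⟨posSemidef_maxEnt m, trace_maxEnt hm⟩

theorem maxEnt_mul_maxEnt {m : ℕ} (hm : 1 ≤ m) : maxEnt m * maxEnt m = maxEnt m := by
  have h : star (maxEntVec m) ⬝ᵥ maxEntVec m = 1 := by
    rw [dotProduct_comm, ← trace_vecMulVec]
    exact trace_maxEnt hm
  rw [maxEnt, vecMulVec_mul_vecMulVec, h, one_smul]

theorem isEffect_maxEnt {m : ℕ} (hm : 1 ≤ m) : IsEffect (maxEnt m) :=
  isEffect_of_mul_self (posSemidef_maxEnt m).1 (maxEnt_mul_maxEnt hm)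

theorem maxEnt_one_mem_PPTplus : maxEnt 1 ∈ PPTplus (Fin 1) (Fin 1) := by
  obtain ⟨hpos, htrace⟩ := isState_maxEnt le_rfl
  have hswap : swapOp 1 = 1 := Matrix.ext fun p q => by
    simp [swapOp, one_apply, Subsingleton.elim q.swap q]
  refine ⟨hpos.1, htrace, hpos, ?_⟩
  rw [ptB_maxEnt, hswap]
  exact PosSemidef.one.smul (by positivity)

theorem hs_maxEnt_le {m : ℕ} {X : Op (Fin m × Fin m)} (hX : X ∈ PPTprime (Fin m) (Fin m)) :
    hs (maxEnt m) X ≤ (m : ℝ)⁻¹ := by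
  rw [PPTprime_eq_image] at hX
  obtain ⟨⟨P, N⟩, ⟨⟨hP, hN⟩, h⟩, rfl⟩ := hX
  have hbound : hs (swapOp m) P + hs (-swapOp m) N ≤ 1 :=
    (add_le_add (hs_le_trace_re (posSemidef_one_sub_swapOp m) hP) (hs_le_trace_re
      (by rw [sub_neg_eq_add]; exact posSemidef_one_add_swapOp m) hN)).trans h
  rw [hs_neg_left, ← sub_eq_add_neg, ← hs_sub_right] at hbound
  change hs (maxEnt m) (ptB (P - N)) ≤ _
  rw [← hs_ptB_left (posSemidef_maxEnt m).1, ptB_maxEnt, hs_smul_left]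
  exact mul_le_of_le_one_right (by positivity) hbound

/-- The state proportional to the projection onto the orthogonal complement of `Ψ_m`; for `m ≤ 1`
it is the junk value `0`. -/
noncomputable def coMaxEnt (m : ℕ) : Op (Fin m × Fin m) := ((m : ℝ) ^ 2 - 1)⁻¹ • (1 - maxEnt m)

theorem isState_coMaxEnt {m : ℕ} (hm : 2 ≤ m) : IsState (coMaxEnt m) := by
  have hpos : (0 : ℝ) < (m : ℝ) ^ 2 - 1 := by
    have : (2 : ℝ) ≤ m := by exact_mod_cast hm
    nlinarith
  have htrace : (1 - maxEnt m).trace.re = (m : ℝ) ^ 2 - 1 := by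
    simp [trace_maxEnt (one_le_two.trans hm), sq]
  refine ⟨(isEffect_maxEnt (one_le_two.trans hm)).2.smul
    (inv_nonneg.mpr hpos.le), ?_⟩
  rw [coMaxEnt, ← htrace]
  exact trace_inv_trace_re_smul (isEffect_maxEnt (one_le_two.trans hm)).2.1 (htrace ▸ hpos.ne')

theorem hs_maxEnt_coMaxEnt {m : ℕ} (hm : 1 ≤ m) : hs (maxEnt m) (coMaxEnt m) = 0 := by
  rw [coMaxEnt, hs_smul_right, hs_eq_trace_mul_re (posSemidef_maxEnt m).1, Matrix.mul_sub,
    Matrix.mul_one, maxEnt_mul_maxEnt hm, sub_self, trace_zero, Complex.zero_re, mul_zero]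

theorem hs_maxEnt_maxEnt {m : ℕ} (hm : 1 ≤ m) : hs (maxEnt m) (maxEnt m) = 1 := by
  rw [hs_eq_trace_mul_re (posSemidef_maxEnt m).1, maxEnt_mul_maxEnt hm, trace_maxEnt hm,
    Complex.one_re]

/-- The normalized projection onto the symmetric subspace. -/
noncomputable def symmState (m : ℕ) : Op (Fin m × Fin m) := (m * (m + 1) : ℝ)⁻¹ • (1 + swapOp m)

/-- The normalized projection onto the antisymmetric subspace; for `m ≤ 1` it is `0`. -/
noncomputable def antisymmState (m : ℕ) : Op (Fin m × Fin m) :=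
  (m * (m - 1) : ℝ)⁻¹ • (1 - swapOp m)

theorem posSemidef_symmState (m : ℕ) : (symmState m).PosSemidef :=
  (posSemidef_one_add_swapOp m).smul (by positivity)

theorem posSemidef_antisymmState {m : ℕ} (hm : 2 ≤ m) : (antisymmState m).PosSemidef := by
  have : (0 : ℝ) ≤ m - 1 := sub_nonneg.mpr (by exact_mod_cast one_le_two.trans hm)
  exact (posSemidef_one_sub_swapOp m).smul (by positivity)

theorem ptB_maxEnt_eq_symmState_sub {m : ℕ} (hm : 2 ≤ m) : ptB (maxEnt m) =
    ((m + 1) / 2 : ℝ) • symmState m - ((m - 1) / 2 : ℝ) • antisymmState m := by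
  have h1 : (m : ℝ) - 1 ≠ 0 := sub_ne_zero.mpr (by exact_mod_cast (by omega : m ≠ 1))
  rw [ptB_maxEnt, symmState, antisymmState]
  match_scalars <;> field_simp <;> ring

theorem ptB_coMaxEnt_eq_symmState_add {m : ℕ} (hm : 2 ≤ m) :
    ptB (coMaxEnt m) = (1 / 2 : ℝ) • symmState m + (1 / 2 : ℝ) • antisymmState m := by
  have h1 : (m : ℝ) - 1 ≠ 0 := sub_ne_zero.mpr (by exact_mod_cast (by omega : m ≠ 1))
  have hfactor : (m : ℝ) ^ 2 - 1 = (m - 1) * (m + 1) := by ring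
  rw [coMaxEnt, ptB_smul, ptB_sub, ptB_one, ptB_maxEnt, symmState, antisymmState, hfactor]
  match_scalars <;> field_simp <;> ring

theorem posSemidef_smul_ptB_maxEnt_add {m : ℕ} (hm : 2 ≤ m) {t : ℝ} (h1 : 0 ≤ 1 + m * t)
    (h2 : 0 ≤ 1 - m * t) : (t • ptB (maxEnt m) + (1 - t) • ptB (coMaxEnt m)).PosSemidef := by
  have hwerner : t • ptB (maxEnt m) + (1 - t) • ptB (coMaxEnt m) =
      ((1 + m * t) / 2) • symmState m + ((1 - m * t) / 2) • antisymmState m := by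
    rw [ptB_maxEnt_eq_symmState_sub hm, ptB_coMaxEnt_eq_symmState_add hm]
    module
  rw [hwerner]
  exact ((posSemidef_symmState m).smul (by positivity)).add
    ((posSemidef_antisymmState hm).smul (by positivity))

theorem posSemidef_kronecker_ptB_maxEnt_add {K : Type*} [Finite K] [DecidableEq K] {m : ℕ}
    (hm : 2 ≤ m) {w : Op K} (h1 : (1 + (m : ℝ) • w).PosSemidef)
    (h2 : (1 - (m : ℝ) • w).PosSemidef) :
    (w ⊗ₖ ptB (maxEnt m) + (1 - w) ⊗ₖ ptB (coMaxEnt m)).PosSemidef := by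
  have hwerner : w ⊗ₖ ptB (maxEnt m) + (1 - w) ⊗ₖ ptB (coMaxEnt m) =
      (1 / 2 : ℝ) • ((1 + (m : ℝ) • w) ⊗ₖ symmState m + (1 - (m : ℝ) • w) ⊗ₖ antisymmState m) := by
    rw [ptB_maxEnt_eq_symmState_sub hm, ptB_coMaxEnt_eq_symmState_add hm]
    ext p q
    simp only [Matrix.add_apply, Matrix.sub_apply, Matrix.smul_apply, kroneckerMap_apply,
      Complex.real_smul]
    push_cast
    ring
  rw [hwerner]
  exact ((h1.kronecker (posSemidef_symmState m)).add
    (h2.kronecker (posSemidef_antisymmState hm))).smul (by positivity)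

end MaximallyEntangled

section Feasible

variable {I : Type*} [Fintype I] [DecidableEq I]

/-- The feasible set of the optimization problem `G m Q`, with the membership in `(1/m) Q°` spelled
out. -/
def feasible (m : ℕ) (Q : Set (Op I)) : Set (Op I) :=
  {W | IsEffect W ∧ ∀ X ∈ Q, hs W X ≤ (m : ℝ)⁻¹}

theorem G_eq_sSup_image {m : ℕ} (hm : 1 ≤ m) (Q : Set (Op I)) (ρ : Op I) :
    G m Q ρ = sSup (hs ρ '' feasible m Q) := by
  have h0 : (0 : ℝ) < m := by exact_mod_cast hm
  have hpolar {W : Op I} (hW : W.IsHermitian) :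
      W ∈ (m : ℝ)⁻¹ • polar Q ↔ ∀ X ∈ Q, hs W X ≤ (m : ℝ)⁻¹ := by
    rw [Set.mem_inv_smul_set_iff₀ h0.ne', polar]
    simp only [Set.mem_ofPred_eq, hs_smul_left, ← one_div, le_div_iff₀' h0, and_iff_right_iff_imp]
    exact fun _ => hW.smul (IsSelfAdjoint.all _)
  unfold G
  congr 1
  ext r
  constructor
  · rintro ⟨W, h1, h2, h3, rfl⟩
    exact ⟨W, ⟨⟨h1, h2⟩, (hpolar h1.1).mp h3⟩, rfl⟩
  · rintro ⟨W, ⟨⟨h1, h2⟩, h3⟩, rfl⟩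
    exact ⟨W, h1, h2, (hpolar h1.1).mpr h3, rfl⟩

theorem isCompact_feasible (m : ℕ) (Q : Set (Op I)) : IsCompact (feasible m Q) := by
  have hclosed : IsClosed (⋂ X ∈ Q, {W : Op I | hs W X ≤ (m : ℝ)⁻¹}) :=
    isClosed_biInter fun X _ => isClosed_le (continuous_hs_left X) continuous_const
  convert isCompact_setOf_isEffect.inter_right hclosed using 1
  ext W
  simp only [feasible, Set.mem_ofPred_eq, Set.mem_inter_iff, Set.mem_iInter]

theorem zero_mem_feasible (m : ℕ) (Q : Set (Op I)) : (0 : Op I) ∈ feasible m Q :=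
  ⟨isEffect_zero, fun X _ => by rw [hs_zero_left]; positivity⟩

theorem le_G_iff {m : ℕ} (hm : 1 ≤ m) {Q : Set (Op I)} {ρ : Op I} {c : ℝ} :
    c ≤ G m Q ρ ↔ ∃ W ∈ feasible m Q, c ≤ hs ρ W := by
  have hK := (isCompact_feasible m Q).image (continuous_hs_right ρ)
  rw [G_eq_sSup_image hm]
  constructor
  · intro h
    obtain ⟨W, hW, hW'⟩ := hK.sSup_mem ⟨_, 0, zero_mem_feasible m Q, rfl⟩
    exact ⟨W, hW, hW' ▸ h⟩
  · rintro ⟨W, hW, h⟩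
    exact h.trans (le_csSup hK.bddAbove ⟨W, hW, rfl⟩)

end Feasible

section Fidelity

variable {A B : Type*} [Fintype A] [DecidableEq A] [Fintype B] [DecidableEq B]

theorem IsCPTP.exists_mem_feasible {Q : Set (Op (A × B))} {m : ℕ} (hm : 1 ≤ m)
    {Λ : SuperOp (A × B) (Fin m × Fin m)} (hΛ : IsCPTP Λ)
    (hQ : ∀ X ∈ Q, Λ X ∈ PPTprime (Fin m) (Fin m)) :
    ∃ W ∈ feasible m Q, ∀ X, hs (Λ X) (maxEnt m) = hs X W := by
  have hW := hΛ.isEffect_heisenberg (isEffect_maxEnt hm)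
  have hpull (X : Op (A × B)) : hs (heisenberg Λ (maxEnt m)) X = hs (maxEnt m) (Λ X) := by
    rw [hs_eq_trace_mul_re hW.1.1, trace_heisenberg_mul,
      hs_eq_trace_mul_re (posSemidef_maxEnt m).1]
  refine ⟨_, ⟨hW, fun X hX => (hpull X).trans_le (hs_maxEnt_le (hQ X hX))⟩, fun X => ?_⟩
  rw [hs_comm, ← hpull, hs_comm]

/-- The channel measuring the effect `W` and preparing `Ψ_m` if it occurs, and otherwise the
complementary state, so that its output is an isotropic state. -/
noncomputable def isotropicPrep (m : ℕ) (W : Op (A × B)) : SuperOp (A × B) (Fin m × Fin m) :=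
  measurePrepare W (maxEnt m) (coMaxEnt m)

theorem isotropicPrep_apply (m : ℕ) {W X : Op (A × B)} (hW : W.IsHermitian) (hX : X.IsHermitian) :
    isotropicPrep m W X = hs W X • maxEnt m + (X.trace.re - hs W X) • coMaxEnt m := by
  rw [isotropicPrep, measurePrepare_apply, trace_mul_eq_hs hW hX,
    trace_mul_eq_hs (isHermitian_one.sub hW) hX, hs_sub_left, hs_one_left]
  simp only [Complex.coe_smul]

theorem hs_isotropicPrep {m : ℕ} (hm : 1 ≤ m) {W X : Op (A × B)} (hW : W.IsHermitian)
    (hX : X.IsHermitian) : hs (isotropicPrep m W X) (maxEnt m) = hs X W := by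
  rw [isotropicPrep_apply m hW hX, hs_comm, hs_comm X, hs_add_right, hs_smul_right, hs_smul_right,
    hs_maxEnt_maxEnt hm, hs_maxEnt_coMaxEnt hm, mul_one, mul_zero, add_zero]

theorem isCPTP_isotropicPrep {m : ℕ} (hm : 2 ≤ m) {W : Op (A × B)} (hW : IsEffect W) :
    IsCPTP (isotropicPrep m W) :=
  isCPTP_measurePrepare hW (isState_maxEnt (one_le_two.trans hm)) (isState_coMaxEnt hm)

theorem isotropicPrep_mem_PPTplusPres {m : ℕ} (hm : 2 ≤ m) {W : Op (A × B)}
    (hW : W ∈ feasible m (PPTplus A B)) :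
    isotropicPrep m W ∈ PPTplusPres A B (Fin m) (Fin m) := by
  have hm0 : (0 : ℝ) < m := by exact_mod_cast two_pos.trans_le hm
  obtain ⟨hW, hQ⟩ := hW
  have hΛ := isCPTP_isotropicPrep hm hW
  refine ⟨hΛ, fun X hX => ?_⟩
  have hpos := hΛ.1.posSemidef_apply hX.2.2.1
  refine ⟨hpos.1, by rw [hΛ.2, hX.2.1], hpos, ?_⟩
  rw [isotropicPrep_apply m hW.1.1 hX.1, hX.2.1, Complex.one_re, ptB_add, ptB_smul, ptB_smul]
  have h0 : 0 ≤ hs W X := hs_nonneg hW.1 hX.2.2.1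
  have h1 : m * hs W X ≤ 1 := by
    rw [← le_div_iff₀' hm0, one_div]
    exact hQ X hX
  exact posSemidef_smul_ptB_maxEnt_add hm (by positivity) (sub_nonneg.mpr h1)

theorem posSemidef_one_sub_smul_ptB {H : Op (A × B)} (hH : H.IsHermitian) {m : ℕ} (hm : 1 ≤ m)
    (h : ∀ X ∈ PPT A B, hs H X ≤ (m : ℝ)⁻¹) : (1 - (m : ℝ) • ptB H).PosSemidef := by
  have hm0 : (0 : ℝ) < m := by exact_mod_cast hm
  refine posSemidef_one_sub_of_forall_hs_le_one
    ((isHermitian_ptB hH).smul (IsSelfAdjoint.all _)) fun P hP => ?_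
  rw [hs_smul_left, hs_ptB_left hH, ← le_div_iff₀' hm0, one_div]
  exact h _ (ptB_mem_PPT hP)

theorem isotropicPrep_mem_PPTops {m : ℕ} (hm : 2 ≤ m) {W : Op (A × B)}
    (hW : W ∈ feasible m (PPTprime A B)) : isotropicPrep m W ∈ PPTops A B (Fin m) (Fin m) := by
  obtain ⟨hW, hQ⟩ := hW
  refine ⟨isCPTP_isotropicPrep hm hW, ?_⟩
  have hsub := posSemidef_one_sub_smul_ptB hW.1.1 (one_le_two.trans hm) fun X hX =>
    hQ X (PPT_subset_PPTprime hX)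
  have hadd := posSemidef_one_sub_smul_ptB hW.1.1.neg (one_le_two.trans hm) fun X hX => by
    rw [hs_neg_left, ← hs_neg_right]
    exact hQ _ (neg_mem_PPTprime (PPT_subset_PPTprime hX))
  rw [ptB_neg, smul_neg, sub_neg_eq_add] at hadd
  rw [isotropicPrep, ptBB'_choi_measurePrepare]
  exact posSemidef_kronecker_ptB_maxEnt_add hm (by simpa using hadd.transpose)
    (by simpa using hsub.transpose)

theorem exists_mem_PPTops_hs_eq_one {ρ : Op (A × B)} (hρ : IsState ρ) :
    ∃ Λ ∈ PPTops A B (Fin 1) (Fin 1), hs (Λ ρ) (maxEnt 1) = 1 := by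
  refine ⟨_, measurePrepare_one_mem_PPTops maxEnt_one_mem_PPTplus, ?_⟩
  rw [measurePrepare_apply, sub_self, Matrix.zero_mul, trace_zero, zero_smul, add_zero,
    Matrix.one_mul, hρ.2, one_smul, hs_maxEnt_maxEnt le_rfl]

theorem Fid_eq_G {O : OpClass A B} {Q : Set (Op (A × B))} {ρ : Op (A × B)} (hρ : IsState ρ) {m : ℕ}
    (hm : 1 ≤ m) (hO : ∀ Λ ∈ O m, IsCPTP Λ ∧ ∀ X ∈ Q, Λ X ∈ PPTprime (Fin m) (Fin m))
    (hops : PPTops A B (Fin m) (Fin m) ⊆ O m)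
    (hprep : 2 ≤ m → ∀ W ∈ feasible m Q, isotropicPrep m W ∈ O m) : Fid O ρ m = G m Q ρ := by
  have hle : ∀ r ∈ {r | ∃ Λ ∈ O m, r = hs (Λ ρ) (maxEnt m)}, r ≤ G m Q ρ := by
    rintro _ ⟨Λ, hΛ, rfl⟩
    obtain ⟨W, hW, h⟩ := (hO Λ hΛ).1.exists_mem_feasible hm (hO Λ hΛ).2
    exact (le_G_iff hm).mpr ⟨W, hW, (h ρ).le⟩
  have hge {W : Op (A × B)} (hW : W ∈ feasible m Q) : ∃ Λ ∈ O m, hs ρ W ≤ hs (Λ ρ) (maxEnt m) := by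
    rcases hm.eq_or_lt with rfl | hm2
    · obtain ⟨Λ, hΛ, h⟩ := exists_mem_PPTops_hs_eq_one hρ
      refine ⟨Λ, hops hΛ, ?_⟩
      have := hs_le_trace_re hW.1.2 hρ.1
      rwa [hρ.2, Complex.one_re, hs_comm, ← h] at this
    · exact ⟨_, hprep hm2 W hW, (hs_isotropicPrep hm hW.1.1.1 hρ.1.1).ge⟩
  obtain ⟨Λ₀, hΛ₀, -⟩ := hge (zero_mem_feasible m Q)
  refine le_antisymm (csSup_le ⟨_, Λ₀, hΛ₀, rfl⟩ hle) ?_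
  obtain ⟨W, hW, h⟩ := (le_G_iff hm).mp (le_refl (G m Q ρ))
  obtain ⟨Λ, hΛ, h'⟩ := hge hW
  exact h.trans (h'.trans (le_csSup ⟨_, hle⟩ ⟨Λ, hΛ, rfl⟩))

theorem Fid_PPTplusPres {ρ : Op (A × B)} (hρ : IsState ρ) {m : ℕ} (hm : 1 ≤ m) :
    Fid (fun k => PPTplusPres A B (Fin k) (Fin k)) ρ m = G m (PPTplus A B) ρ :=
  Fid_eq_G hρ hm
    (fun _ hΛ => ⟨hΛ.1, fun X hX => PPT_subset_PPTprime (PPTplus_subset_PPT (hΛ.2 X hX))⟩)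
    (PPTops_subset_PPTpres.trans PPTpres_subset_PPTplusPres)
    fun hm2 _ => isotropicPrep_mem_PPTplusPres hm2

variable [Nonempty A] [Nonempty B]

theorem Fid_PPTpres {ρ : Op (A × B)} (hρ : IsState ρ) {m : ℕ} (hm : 1 ≤ m) :
    Fid (fun k => PPTpres A B (Fin k) (Fin k)) ρ m = G m (PPTprime A B) ρ :=
  Fid_eq_G hρ hm (fun _ hΛ => ⟨hΛ.1, fun _ => apply_mem_PPTprime hΛ.2⟩) PPTops_subset_PPTpres
    fun hm2 _ hW => PPTops_subset_PPTpres (isotropicPrep_mem_PPTops hm2 hW)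

theorem Fid_PPTops {ρ : Op (A × B)} (hρ : IsState ρ) {m : ℕ} (hm : 1 ≤ m) :
    Fid (fun k => PPTops A B (Fin k) (Fin k)) ρ m = G m (PPTprime A B) ρ :=
  Fid_eq_G hρ hm
    (fun _ hΛ => ⟨hΛ.1, fun _ => apply_mem_PPTprime (PPTops_subset_PPTpres hΛ).2⟩)
    Set.Subset.rfl fun hm2 _ => isotropicPrep_mem_PPTops hm2

end Fidelity

section HypothesisTesting

variable {I : Type*} [Fintype I]

/-- The properties of a set `Q` of operators used to bound one-shot distillation by hypothesis
testing against `Q`. The positive definite element keeps the optimal error positive. -/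
structure IsReferenceSet (Q : Set (Op I)) : Prop where
  isCompact : IsCompact Q
  convex : Convex ℝ Q
  trace_re_le_one : ∀ X ∈ Q, X.trace.re ≤ 1
  exists_posDef : ∃ X ∈ Q, X.PosDef

theorem IsReferenceSet.nonempty {Q : Set (Op I)} (hQ : IsReferenceSet Q) : Q.Nonempty :=
  let ⟨X, hX, _⟩ := hQ.exists_posDef
  ⟨X, hX⟩

variable [DecidableEq I]

/-- The effects detecting `ρ` with error at most `ε`, over which `DH` minimizes. -/
def tests (ε : ℝ) (ρ : Op I) : Set (Op I) := {M | IsEffect M ∧ 1 - hs M ρ ≤ ε}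

theorem DH_eq_neg_log2_sInf_image (ε : ℝ) (ρ X : Op I) :
    DH ε ρ X = -log2 (sInf ((fun M => hs M X) '' tests ε ρ)) := by
  unfold DH
  congr 3
  ext r
  constructor
  · rintro ⟨M, h1, h2, h3, rfl⟩
    exact ⟨M, ⟨⟨h1, h2⟩, h3⟩, rfl⟩
  · rintro ⟨M, ⟨⟨h1, h2⟩, h3⟩, rfl⟩
    exact ⟨M, h1, h2, h3, rfl⟩

theorem one_mem_tests {ε : ℝ} (hε : 0 ≤ ε) {ρ : Op I} (hρ : ρ.trace = 1) : 1 ∈ tests ε ρ :=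
  ⟨isEffect_one, by rwa [hs_one_left, hρ, Complex.one_re, sub_self]⟩

theorem isCompact_tests (ε : ℝ) (ρ : Op I) : IsCompact (tests ε ρ) :=
  isCompact_setOf_isEffect.inter_right
    (isClosed_le (continuous_const.sub (continuous_hs_left ρ)) continuous_const)

theorem convex_tests (ε : ℝ) (ρ : Op I) : Convex ℝ (tests ε ρ) := by
  convert convex_setOf_isEffect.inter (convex_halfSpace_ge (hsForm.flip ρ).isLinear (1 - ε)) using 1
  ext M
  exact and_congr_right fun _ => sub_le_comm

theorem log2_mono : Monotone log2 := by
  intro x y hxy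
  unfold log2
  split_ifs with hx hy hy
  · exact le_rfl
  · exact bot_le
  · exact absurd (hxy.trans hy) hx
  · exact EReal.coe_le_coe_iff.mpr (Real.logb_le_logb_of_le one_lt_two (not_le.mp hx) hxy)

theorem neg_log2_hs_le_DH {ε : ℝ} {ρ M : Op I} (hM : M ∈ tests ε ρ) (X : Op I) :
    -log2 (hs M X) ≤ DH ε ρ X := by
  have hbdd := ((isCompact_tests ε ρ).image (continuous_hs_left X)).bddBelow
  rw [DH_eq_neg_log2_sInf_image, EReal.neg_le_neg_iff]
  exact log2_mono (csInf_le hbdd ⟨M, hM, rfl⟩)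

theorem DH_eq_top {ε : ℝ} (hε : 1 ≤ ε) (ρ X : Op I) : DH ε ρ X = ⊤ := by
  have h0 : (0 : Op I) ∈ tests ε ρ := ⟨isEffect_zero, by rwa [hs_zero_left, sub_zero]⟩
  have h := neg_log2_hs_le_DH h0 X
  rwa [hs_zero_left, log2, if_pos le_rfl, EReal.neg_bot, top_le_iff] at h

theorem exists_isSaddlePointOn_tests {Q : Set (Op I)} (hQ : IsCompact Q) (hconv : Convex ℝ Q)
    (hne : Q.Nonempty) {ρ : Op I} (hρ : ρ.trace = 1) {ε : ℝ} (hε : 0 ≤ ε) :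
    ∃ M ∈ tests ε ρ, ∃ X ∈ Q, IsSaddlePointOn (tests ε ρ) Q hs M X :=
  Sion.exists_isSaddlePointOn ⟨1, one_mem_tests hε hρ⟩ (convex_tests ε ρ) (isCompact_tests ε ρ)
    (fun X _ => (continuous_hs_left X).continuousOn.lowerSemicontinuousOn)
    (fun X _ => ((hsForm.flip X).convexOn (convex_tests ε ρ)).quasiconvexOn)
    hconv hne hQ
    (fun M _ => (continuous_hs_right M).continuousOn.upperSemicontinuousOn)
    (fun M _ => ((hsForm M).concaveOn hconv).quasiconcaveOn)

section SaddlePoint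

variable {Q : Set (Op I)} {ε : ℝ} {ρ M X : Op I}

theorem isLeast_DH_of_isSaddlePointOn (hM : M ∈ tests ε ρ) (hX : X ∈ Q)
    (h : IsSaddlePointOn (tests ε ρ) Q hs M X) : IsLeast (DH ε ρ '' Q) (-log2 (hs M X)) := by
  have hmin : IsLeast ((fun N => hs N X) '' tests ε ρ) (hs M X) :=
    ⟨⟨M, hM, rfl⟩, by rintro _ ⟨N, hN, rfl⟩; exact h N hN X hX⟩
  refine ⟨⟨X, hX, by rw [DH_eq_neg_log2_sInf_image, hmin.csInf_eq]⟩, ?_⟩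
  rintro _ ⟨Y, hY, rfl⟩
  exact (EReal.neg_le_neg_iff.mpr (log2_mono (h M hM Y hY))).trans (neg_log2_hs_le_DH hM Y)

theorem le_G_iff_of_isSaddlePointOn (hM : M ∈ tests ε ρ) (hX : X ∈ Q)
    (h : IsSaddlePointOn (tests ε ρ) Q hs M X) {m : ℕ} (hm : 1 ≤ m) :
    1 - ε ≤ G m Q ρ ↔ hs M X ≤ (m : ℝ)⁻¹ := by
  rw [le_G_iff hm]
  constructor
  · rintro ⟨W, ⟨hW, hWQ⟩, hWρ⟩
    have hWtest : W ∈ tests ε ρ := ⟨hW, by rwa [hs_comm, sub_le_comm]⟩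
    exact (h W hWtest X hX).trans (hWQ X hX)
  · intro hle
    refine ⟨M, ⟨hM.1, fun Y hY => (h M hM Y hY).trans hle⟩, ?_⟩
    rw [hs_comm]
    exact sub_le_comm.mp hM.2

end SaddlePoint

theorem IsReferenceSet.exists_testing_value {Q : Set (Op I)} (hQ : IsReferenceSet Q) {ρ : Op I}
    (hρ : ρ.trace = 1) {ε : ℝ} (h0 : 0 ≤ ε) (h1 : ε < 1) :
    ∃ v : ℝ, 0 < v ∧ v ≤ 1 ∧ IsLeast (DH ε ρ '' Q) (-log2 v) ∧
      ∀ m : ℕ, 1 ≤ m → (1 - ε ≤ G m Q ρ ↔ v ≤ (m : ℝ)⁻¹) := by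
  obtain ⟨M, hM, X, hX, h⟩ :=
    exists_isSaddlePointOn_tests hQ.isCompact hQ.convex hQ.nonempty hρ h0
  have hM0 : M ≠ 0 := by
    rintro rfl
    have := hM.2
    rw [hs_zero_left] at this
    linarith
  obtain ⟨X₀, hX₀, hpos⟩ := hQ.exists_posDef
  refine ⟨hs M X, (hs_pos hM.1.1 hM0 hpos).trans_le (h M hM X₀ hX₀), ?_,
    isLeast_DH_of_isSaddlePointOn hM hX h, fun m => le_G_iff_of_isSaddlePointOn hM hX h⟩
  calc hs M X ≤ hs 1 X := h 1 (one_mem_tests h0 hρ) X hX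
    _ = X.trace.re := hs_one_left X
    _ ≤ 1 := hQ.trace_re_le_one X hX

end HypothesisTesting

section OneShot

theorem logFloor_neg_log2 {v : ℝ} (hv : 0 < v) : logFloor (-log2 v) = log2 (⌊v⁻¹⌋₊ : ℝ) := by
  have h : -log2 v = ((-Real.logb 2 v : ℝ) : EReal) := by
    rw [log2, if_neg (not_le.mpr hv), EReal.coe_neg]
  rw [h, logFloor, if_neg (EReal.coe_ne_top _), if_neg (EReal.coe_ne_bot _), EReal.toReal_coe,
    Real.rpow_neg zero_le_two, Real.rpow_logb two_pos (by norm_num) hv,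
    natCast_floor_eq_intCast_floor (inv_nonneg.mpr hv.le)]

section Achievable

variable {A B : Type*} {O : OpClass A B} {ε : ℝ} {ρ : Op (A × B)}

theorem isGreatest_achievable {v : ℝ} (hv : 0 < v) (hv1 : v ≤ 1)
    (h : ∀ m : ℕ, 1 ≤ m → (1 - ε ≤ Fid O ρ m ↔ v ≤ (m : ℝ)⁻¹)) :
    IsGreatest (achievable O ε ρ) ⌊v⁻¹⌋₊ := by
  have hle {m : ℕ} (hm : 1 ≤ m) : v ≤ (m : ℝ)⁻¹ ↔ m ≤ ⌊v⁻¹⌋₊ := by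
    rw [Nat.le_floor_iff (inv_nonneg.mpr hv.le), le_inv_comm₀ hv (by exact_mod_cast hm)]
  have h1 : 1 ≤ ⌊v⁻¹⌋₊ := (hle le_rfl).mp (by simpa using hv1)
  exact ⟨⟨h1, (h _ h1).mpr ((hle h1).mpr le_rfl)⟩,
    fun m hm => (hle hm.1).mp ((h m hm.1).mp hm.2)⟩

theorem log2_le_Edist {m : ℕ} (hm : m ∈ achievable O ε ρ) : log2 m ≤ Edist O ε ρ :=
  le_iSup₂ (f := fun (m : ℕ) (_ : m ∈ achievable O ε ρ) => log2 (m : ℝ)) m hm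

theorem Edist_eq_of_isGreatest {N : ℕ} (h : IsGreatest (achievable O ε ρ) N) :
    Edist O ε ρ = log2 N :=
  le_antisymm (iSup₂_le fun _ hm => log2_mono (Nat.cast_le.mpr (h.2 hm))) (log2_le_Edist h.1)

theorem Edist_eq_top (h : ∀ m : ℕ, 1 ≤ m → m ∈ achievable O ε ρ) : Edist O ε ρ = ⊤ := by
  refine (EReal.eq_top_iff_forall_lt _).mpr fun y => ?_
  obtain ⟨n, hn⟩ := exists_nat_gt ((2 : ℝ) ^ y)
  have hn0 : (0 : ℝ) < n := (Real.rpow_pos_of_pos two_pos y).trans hn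
  have hlt : (y : EReal) < log2 n := by
    rw [log2, if_neg (not_le.mpr hn0), EReal.coe_lt_coe_iff]
    exact (Real.lt_logb_iff_rpow_lt one_lt_two hn0).mpr hn
  exact hlt.trans_le (log2_le_Edist (h n (by exact_mod_cast hn0)))

theorem achievable_congr {O' : OpClass A B} (ε : ℝ)
    (h : ∀ m : ℕ, 1 ≤ m → Fid O ρ m = Fid O' ρ m) : achievable O ε ρ = achievable O' ε ρ := by
  ext m
  exact and_congr_right fun hm => by rw [h m hm]

theorem Edist_congr {O' : OpClass A B} (ε : ℝ) (h : ∀ m : ℕ, 1 ≤ m → Fid O ρ m = Fid O' ρ m) :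
    Edist O ε ρ = Edist O' ε ρ := by
  rw [Edist, achievable_congr ε h, Edist]

end Achievable

variable {A B : Type*} [Fintype A] [DecidableEq A] [Fintype B] [DecidableEq B]

section ReferenceSet

variable {Q : Set (Op (A × B))} {ρ : Op (A × B)} {O : OpClass A B} {ε : ℝ}

theorem IsReferenceSet.exists_isGreatest_achievable (hQ : IsReferenceSet Q) (hρ : ρ.trace = 1)
    (hO : ∀ m : ℕ, 1 ≤ m → Fid O ρ m = G m Q ρ) (h0 : 0 ≤ ε) (h1 : ε < 1) :
    ∃ N, IsGreatest (achievable O ε ρ) N := by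
  obtain ⟨v, hv, hv1, -, hG⟩ := hQ.exists_testing_value hρ h0 h1
  exact ⟨_, isGreatest_achievable hv hv1 fun m hm => by rw [hO m hm]; exact hG m hm⟩

theorem IsReferenceSet.exists_isLeast_DH_Edist_eq (hQ : IsReferenceSet Q) (hρ : ρ.trace = 1)
    (hO : ∀ m : ℕ, 1 ≤ m → Fid O ρ m = G m Q ρ) (h0 : 0 ≤ ε) :
    ∃ t : EReal, IsLeast (DH ε ρ '' Q) t ∧ Edist O ε ρ = logFloor t := by
  rcases le_or_gt 1 ε with h1 | h1
  · have hDH : DH ε ρ '' Q = {⊤} := by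
      rw [← hQ.nonempty.image_const (⊤ : EReal)]
      exact Set.image_congr fun X _ => DH_eq_top h1 ρ X
    refine ⟨⊤, hDH ▸ isLeast_singleton, ?_⟩
    rw [logFloor, if_pos rfl]
    refine Edist_eq_top fun m hm => ⟨hm, ?_⟩
    rw [hO m hm, le_G_iff hm]
    exact ⟨0, zero_mem_feasible m Q, by rwa [hs_comm, hs_zero_left, sub_nonpos]⟩
  · obtain ⟨v, hv, hv1, hleast, hG⟩ := hQ.exists_testing_value hρ h0 h1
    refine ⟨_, hleast, ?_⟩
    rw [logFloor_neg_log2 hv]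
    exact Edist_eq_of_isGreatest
      (isGreatest_achievable hv hv1 fun m hm => by rw [hO m hm]; exact hG m hm)

end ReferenceSet

theorem IsState.nonempty {I : Type*} [Fintype I] {ρ : Op I} (hρ : IsState ρ) : Nonempty I := by
  by_contra h
  rw [not_nonempty_iff] at h
  simpa [trace] using hρ.2

variable [Nonempty A] [Nonempty B]

theorem isReferenceSet_PPTprime : IsReferenceSet (PPTprime A B) where
  isCompact := isCompact_PPTprime
  convex := convex_PPTprime
  trace_re_le_one _ := trace_re_le_one_of_mem_PPTprime
  exists_posDef :=
    ⟨_, PPT_subset_PPTprime (PPTplus_subset_PPT maxMixed_mem_PPTplus), posDef_maxMixed⟩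

theorem isReferenceSet_PPTplus {A B : Type*} [Fintype A] [Fintype B] [Nonempty A] [Nonempty B] :
    IsReferenceSet (PPTplus A B) where
  isCompact := isCompact_PPTplus
  convex := convex_PPTplus
  trace_re_le_one X hX := by rw [hX.2.1, Complex.one_re]
  exists_posDef := by classical exact ⟨_, maxMixed_mem_PPTplus, posDef_maxMixed⟩

end OneShot

end PPTDist

theorem mainTheorem6 {A B : Type*} [Fintype A] [DecidableEq A] [Fintype B] [DecidableEq B]
    (ρ : PPTDist.Op (A × B)) (hρ : PPTDist.IsState ρ) :
    -- the two descriptions of the set PPT'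
    PPTDist.PPTprime A B = convexHull ℝ (PPTDist.PPT A B ∪ -PPTDist.PPT A B) ∧
    -- fidelity of distillation
    (∀ m : ℕ, 1 ≤ m →
      PPTDist.Fid (fun k => PPTDist.PPTplusPres A B (Fin k) (Fin k)) ρ m
          = PPTDist.G m (PPTDist.PPTplus A B) ρ ∧
      PPTDist.Fid (fun k => PPTDist.PPTops A B (Fin k) (Fin k)) ρ m
          = PPTDist.Fid (fun k => PPTDist.PPTpres A B (Fin k) (Fin k)) ρ m ∧
      PPTDist.Fid (fun k => PPTDist.PPTpres A B (Fin k) (Fin k)) ρ m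
          = PPTDist.G m (PPTDist.PPTprime A B) ρ) ∧
    -- one-shot distillable entanglement
    (∀ ε : ℝ, 0 ≤ ε → ε ≤ 1 →
      (∃ t : EReal, IsLeast (PPTDist.DH ε ρ '' PPTDist.PPTplus A B) t ∧
        PPTDist.Edist (fun k => PPTDist.PPTplusPres A B (Fin k) (Fin k)) ε ρ
          = PPTDist.logFloor t) ∧
      (∃ t : EReal, IsLeast (PPTDist.DH ε ρ '' PPTDist.PPTprime A B) t ∧
        PPTDist.Edist (fun k => PPTDist.PPTops A B (Fin k) (Fin k)) ε ρ
          = PPTDist.Edist (fun k => PPTDist.PPTpres A B (Fin k) (Fin k)) ε ρ ∧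
        PPTDist.Edist (fun k => PPTDist.PPTpres A B (Fin k) (Fin k)) ε ρ
          = PPTDist.logFloor t)) ∧
    -- for `ε < 1` the maxima defining the one-shot distillable entanglement are attained
    (∀ ε : ℝ, 0 ≤ ε → ε < 1 →
      (∃ N : ℕ, IsGreatest
        (PPTDist.achievable (fun k => PPTDist.PPTplusPres A B (Fin k) (Fin k)) ε ρ) N) ∧
      (∃ N : ℕ, IsGreatest
        (PPTDist.achievable (fun k => PPTDist.PPTops A B (Fin k) (Fin k)) ε ρ) N) ∧
      (∃ N : ℕ, IsGreatest
        (PPTDist.achievable (fun k => PPTDist.PPTpres A B (Fin k) (Fin k)) ε ρ) N)) := by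
  obtain ⟨hA, hB⟩ := nonempty_prod.mp hρ.nonempty
  have hplus (m : ℕ) (hm : 1 ≤ m) := PPTDist.Fid_PPTplusPres hρ hm
  have hops (m : ℕ) (hm : 1 ≤ m) := PPTDist.Fid_PPTops hρ hm
  have hpres (m : ℕ) (hm : 1 ≤ m) := PPTDist.Fid_PPTpres hρ hm
  have hops_pres (m : ℕ) (hm : 1 ≤ m) := (hops m hm).trans (hpres m hm).symm
  have hQplus := PPTDist.isReferenceSet_PPTplus (A := A) (B := B)
  have hQprime := PPTDist.isReferenceSet_PPTprime (A := A) (B := B)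
  refine ⟨PPTDist.PPTprime_eq_convexHull, fun m hm => ⟨hplus m hm, hops_pres m hm, hpres m hm⟩,
    fun ε h0 _ => ⟨hQplus.exists_isLeast_DH_Edist_eq hρ.2 hplus h0, ?_⟩, fun ε h0 h1 =>
    ⟨hQplus.exists_isGreatest_achievable hρ.2 hplus h0 h1,
      hQprime.exists_isGreatest_achievable hρ.2 hops h0 h1,
      hQprime.exists_isGreatest_achievable hρ.2 hpres h0 h1⟩⟩
  obtain ⟨t, ht, hE⟩ := hQprime.exists_isLeast_DH_Edist_eq hρ.2 hpres h0
  exact ⟨t, ht, PPTDist.Edist_congr ε hops_pres, hE⟩
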